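/- Let $\lambda,\alpha,\beta>0$ and $\rho_1<\rho_2$ be real constants. Let $(\mu_t)_{t\ge 0}$ be a time-homogeneous continuous-time Markov chain on a probability space, with state space $\{\rho_1,\rho_2\}$, almost surely right-continuous paths, and generator $$G=\begin{pmatrix}-\alpha&\alpha\\ \beta&-\beta\end{pmatrix}$$ (so that its transition matrices are $e^{tG}$), started from its stationary distribution, $\mathbb P(\mu_0=\rho_1)=\frac{\beta}{\alpha+\beta}$ and $\mathbb P(\mu_0=\rho_2)=\frac{\alpha}{\alpha+\beta}$. Then the integral $\int_0^\infty e^{-\lambda s}\mu_s\,ds$ converges absolutely almost surely and is (almost surely equal to) a random variable. Its conditional distribution functions $$u_\infty(x)=\mathbb P\Big(\int_0^\infty e^{-\lambda s}\mu_s\,ds\le x\,\Big|\,\mu_0=\rho_1\Big),\qquad v_\infty(x)=\mathbb P\Big(\int_0^\infty e^{-\lambda s}\mu_s\,ds\le x\,\Big|\,\mu_0=\rho_2\Big)$$ satisfy, for $\frac{\rho_1}{\lambda}<x<\frac{\rho_2}{\lambda}$, $$u_\infty(x)=c\int_{\rho_1/\lambda}^x(\rho_2-\lambda z)\,l(z)\,dz,\qquad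 v_\infty(x)=d\int_{\rho_1/\lambda}^x(\lambda z-\rho_1)\,l(z)\,dz,$$ where $$l(z)=(\lambda z-\rho_1)^{\frac{\alpha}{\lambda}-1}(\rho_2-\lambda z)^{\frac{\beta}{\lambda}-1},\qquad c=\frac{\lambda^2\,\Gamma\big(\frac{\alpha+\beta+\lambda}{\lambda}\big)}{\beta(\rho_2-\rho_1)^{\frac{\alpha+\beta}{\lambda}}\,\Gamma\big(\frac{\alpha}{\lambda}\big)\Gamma\big(\frac{\beta}{\lambda}\big)},\qquad d=\frac{\beta c}{\alpha}.$$ That is, $u_\infty$ and $v_\infty$ are, on all of $\mathbb R$, the distribution functions of scaled and shifted Beta distributions, namely of $\frac{\rho_1+(\rho_2-\rho_1)B}{\lambda}$ with $B\sim\mathrm{Beta}\big(\frac{\alpha}{\lambda},\frac{\beta}{\lambda}+1\big)$ for $u_\infty$ and $B\sim\mathrm{Beta}\big(\frac{\alpha}{\lambda}+1,\frac{\beta}{\lambda}\big)$ for $v_\infty$. -/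

import Mathlib

open MeasureTheory ProbabilityTheory
open scoped NNReal

noncomputable section

/-- The generator (rate) matrix of a two-state chain which jumps from the first state to the
second at rate `α` and from the second state to the first at rate `β`. -/
def twoStateGenerator (α β : ℝ) : Matrix (Fin 2) (Fin 2) ℝ :=
  !![-α, α; β, -β]

/-- The transition matrices `P(t) = exp (t G)`, where `G` is the generator. -/
def twoStateTransition (α β : ℝ) (t : ℝ≥0) : Matrix (Fin 2) (Fin 2) ℝ :=
  NormedSpace.exp ((t : ℝ) • twoStateGenerator α β)

/-- The `σ`-algebra generated by the process up to time `s`. -/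
abbrev historyUpTo {Ω : Type*} (μ : ℝ≥0 → Ω → ℝ) (s : ℝ≥0) : MeasurableSpace Ω :=
  ⨆ r : ℝ≥0, ⨆ _ : r ≤ s, MeasurableSpace.comap (μ r) (inferInstance : MeasurableSpace ℝ)

/-- `μ` is a time-homogeneous continuous-time Markov chain with state space `{ρ₁, ρ₂}` and
generator `[[-α, α], [β, -β]]` (no condition on the initial distribution). -/
structure IsTwoStateCTMC {Ω : Type*} [MeasurableSpace Ω] (P : Measure Ω)
    (ρ₁ ρ₂ α β : ℝ) (μ : ℝ≥0 → Ω → ℝ) : Prop where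
  measurable : ∀ t, Measurable (μ t)
  state_space : ∀ t ω, μ t ω = ρ₁ ∨ μ t ω = ρ₂
  right_continuous : ∀ᵐ ω ∂P, ∀ t : ℝ≥0, ContinuousWithinAt (fun s => μ s ω) (Set.Ici t) t
  /-- The Markov property: conditionally on the history up to time `s`, on `{μ s = ρᵢ}` the
  probability of `{μ (s + t) = ρⱼ}` is `P(t) i j`. -/
  markov : ∀ (s t : ℝ≥0) (A : Set Ω), MeasurableSet[historyUpTo μ s] A → ∀ i j : Fin 2,
    P.real (A ∩ {ω | μ s ω = ![ρ₁, ρ₂] i} ∩ {ω | μ (s + t) ω = ![ρ₁, ρ₂] j}) =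
      P.real (A ∩ {ω | μ s ω = ![ρ₁, ρ₂] i}) * twoStateTransition α β t i j

/-- The perpetuity `∫₀^∞ e^{-lam s} μ_s ds`. -/
def perpetuity {Ω : Type*} (lam : ℝ) (μ : ℝ≥0 → Ω → ℝ) (ω : Ω) : ℝ :=
  ∫ s in Set.Ioi (0 : ℝ), Real.exp (-lam * s) * μ s.toNNReal ω

/-- The conditional c.d.f. of the perpetuity given that `μ_0 = r`. -/
def perpetuityCDFGiven {Ω : Type*} [MeasurableSpace Ω] (P : Measure Ω) (lam : ℝ)
    (μ : ℝ≥0 → Ω → ℝ) (r x : ℝ) : ℝ :=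
  (ProbabilityTheory.cond P {ω | μ 0 ω = r}).real {ω | perpetuity lam μ ω ≤ x}

/-- `l(z) = (lam z - ρ₁)^{α/lam - 1} (ρ₂ - lam z)^{β/lam - 1}`. -/
def limitWeight (ρ₁ ρ₂ α β lam z : ℝ) : ℝ :=
  (lam * z - ρ₁) ^ (α / lam - 1) * (ρ₂ - lam * z) ^ (β / lam - 1)

/-- The normalizing constant of the conditional density given `μ_0 = ρ₁`. -/
def limitConst (ρ₁ ρ₂ α β lam : ℝ) : ℝ :=
  lam ^ 2 * Real.Gamma ((α + β + lam) / lam) /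
    (β * (ρ₂ - ρ₁) ^ ((α + β) / lam) * Real.Gamma (α / lam) * Real.Gamma (β / lam))

/-- The law of `(ρ₁ + (ρ₂ - ρ₁) B) / lam`, where `B` is `Beta(a, b)`-distributed. -/
def scaledBeta (ρ₁ ρ₂ lam a b : ℝ) : Measure ℝ :=
  (betaMeasure a b).map (fun y => (ρ₁ + (ρ₂ - ρ₁) * y) / lam)

end

noncomputable section

/-! Let `Y` be the indicator of the upper state and `Z t` its discounted tail. Since `μ = ρ₁ + (ρ₂ -
ρ₁) Y`, the perpetuity is almost surely `(ρ₁ + (ρ₂ - ρ₁) Z 0) / lam`, so it suffices to find the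
conditional laws of `Z 0`. They live on `[0, 1]`, hence are determined by their moments
(`measure_eq_of_moments_eq`).

Along a path `Z' = -lam e^{-lam t} Y`, so `Z t ^ (n + 1)` is the integral over `u > t` of `(n + 1)
lam e^{-lam u} Y u Z u ^ n` (`discountedTail_pow_succ`). The factor `Y u` restricts to the upper
state at time `u`. The Markov property therefore expresses the moment of order `n + 1` from either
state through the moment of order `n` from the upper state, weighted by an integral of transition
probabilities (`integral_discountedTail_pow`).

With `a = α / lam` and `b = β / lam`, the factor is `a / (a + b + n + 1)` from the lower state and
`(a + n + 1) / (a + b + n + 1)` from the upper. This recursion has the moments of `Beta(a, b + 1)`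
and `Beta(a + 1, b)` as its solution. -/

/-- The discounted integral `∫ₜ^∞ lam e^{-lam u} y(u) du` of a path `y`. -/
def discountedTail (lam : ℝ) (y : ℝ → ℝ) (t : ℝ) : ℝ :=
  ∫ u in Set.Ioi t, lam * Real.exp (-lam * u) * y u

/-! ### Pathwise calculus of discounted tails -/

section DiscountedTail

variable {lam : ℝ} {y : ℝ → ℝ}

theorem integrableOn_discounted (hlam : 0 < lam) (hy : Measurable y)
    (hb : ∀ u, |y u| ≤ 1) (t : ℝ) :
    IntegrableOn (fun u => lam * Real.exp (-lam * u) * y u) (Set.Ioi t) := by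
  have h := (integrableOn_exp_mul_Ioi (a := -lam) (by linarith) t).const_mul lam
  refine Integrable.mono' h (by fun_prop) (ae_of_all _ fun u => ?_)
  rw [norm_mul, Real.norm_of_nonneg (by positivity), Real.norm_eq_abs]
  exact mul_le_of_le_one_right (by positivity) (hb u)

theorem integral_lam_mul_exp_Ioi (hlam : 0 < lam) (t : ℝ) :
    ∫ u in Set.Ioi t, lam * Real.exp (-lam * u) = Real.exp (-lam * t) := by
  rw [integral_const_mul, integral_exp_mul_Ioi (by linarith)]
  field_simp

theorem discountedTail_nonneg (hlam : 0 < lam) (h0 : ∀ u, 0 ≤ y u) (t : ℝ) :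
    0 ≤ discountedTail lam y t :=
  setIntegral_nonneg measurableSet_Ioi fun u _ => by have := h0 u; positivity

theorem discountedTail_le (hlam : 0 < lam) (hy : Measurable y) (h0 : ∀ u, 0 ≤ y u)
    (h1 : ∀ u, y u ≤ 1) (t : ℝ) : discountedTail lam y t ≤ Real.exp (-lam * t) := by
  rw [← integral_lam_mul_exp_Ioi hlam t]
  refine setIntegral_mono
    (integrableOn_discounted hlam hy (fun u => by rw [abs_of_nonneg (h0 u)]; exact h1 u) t)
    ((integrableOn_exp_mul_Ioi (by linarith) t).const_mul lam) fun u => ?_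
  exact mul_le_of_le_one_right (by positivity) (h1 u)

theorem discountedTail_le_one (hlam : 0 < lam) (hy : Measurable y) (h0 : ∀ u, 0 ≤ y u)
    (h1 : ∀ u, y u ≤ 1) {t : ℝ} (ht : 0 ≤ t) : discountedTail lam y t ≤ 1 :=
  (discountedTail_le hlam hy h0 h1 t).trans (Real.exp_le_one_iff.2 (by nlinarith))

theorem discountedTail_eq_sub (hlam : 0 < lam) (hy : Measurable y)
    (hb : ∀ u, |y u| ≤ 1) (t s : ℝ) :
    discountedTail lam y s =
      discountedTail lam y t - ∫ u in t..s, lam * Real.exp (-lam * u) * y u := by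
  have := intervalIntegral.integral_interval_add_Ioi
    (integrableOn_discounted hlam hy hb t) (integrableOn_discounted hlam hy hb s)
  unfold discountedTail
  linarith

theorem intervalIntegrable_discounted (hlam : 0 < lam) (hy : Measurable y)
    (hb : ∀ u, |y u| ≤ 1) (t s : ℝ) :
    IntervalIntegrable (fun u => lam * Real.exp (-lam * u) * y u) volume t s := by
  rw [intervalIntegrable_iff]
  exact (integrableOn_discounted hlam hy hb (min t s)).mono_set fun u hu => hu.1

theorem continuous_discountedTail (hlam : 0 < lam) (hy : Measurable y)
    (hb : ∀ u, |y u| ≤ 1) : Continuous (discountedTail lam y) := by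
  rw [funext (discountedTail_eq_sub hlam hy hb 0)]
  exact continuous_const.sub (intervalIntegral.continuous_primitive
    (fun a b => intervalIntegrable_discounted hlam hy hb a b) 0)

/-- Only a right derivative is available, because paths jump and are merely right-continuous. -/
theorem hasDerivWithinAt_discountedTail (hlam : 0 < lam) (hy : Measurable y)
    (hb : ∀ u, |y u| ≤ 1) {t : ℝ} (hc : ContinuousWithinAt y (Set.Ici t) t) :
    HasDerivWithinAt (discountedTail lam y) (-(lam * Real.exp (-lam * t) * y t))
      (Set.Ioi t) t := by
  rw [funext (discountedTail_eq_sub hlam hy hb 0)]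
  refine HasDerivWithinAt.const_sub _ ?_
  refine (intervalIntegral.integral_hasDerivWithinAt_right (s := Set.Ici t) (t := Set.Ioi t)
    (intervalIntegrable_discounted hlam hy hb 0 t) ?_ ?_).mono Set.Ioi_subset_Ici_self
  · exact (show Measurable fun u => lam * Real.exp (-lam * u) * y u by
      fun_prop).stronglyMeasurable.stronglyMeasurableAtFilter
  · exact ContinuousWithinAt.mul (by fun_prop) (hc.mono Set.Ioi_subset_Ici_self)

theorem tendsto_discountedTail (hlam : 0 < lam) (hy : Measurable y) (h0 : ∀ u, 0 ≤ y u)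
    (h1 : ∀ u, y u ≤ 1) :
    Filter.Tendsto (discountedTail lam y) Filter.atTop (nhds 0) := by
  refine squeeze_zero (discountedTail_nonneg hlam h0) (discountedTail_le hlam hy h0 h1) ?_
  refine Real.tendsto_exp_atBot.comp ?_
  exact Filter.tendsto_id.const_mul_atTop_of_neg (by linarith)

/-- The power of a discounted tail integral as a discounted integral of the previous power. -/
theorem discountedTail_pow_succ (hlam : 0 < lam) (hy : Measurable y) (h0 : ∀ u, 0 ≤ y u)
    (h1 : ∀ u, y u ≤ 1) (hc : ∀ t, 0 ≤ t → ContinuousWithinAt y (Set.Ici t) t)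
    (n : ℕ) {t : ℝ} (ht : 0 ≤ t) :
    discountedTail lam y t ^ (n + 1) =
      ∫ u in Set.Ioi t, (n + 1) * (lam * Real.exp (-lam * u)) *
        (y u * discountedTail lam y u ^ n) := by
  have hb : ∀ u, |y u| ≤ 1 := fun u => by rw [abs_of_nonneg (h0 u)]; exact h1 u
  have hcont := continuous_discountedTail hlam hy hb
  set z := discountedTail lam y with hz
  have hint : IntegrableOn (fun u => (n + 1) * (lam * Real.exp (-lam * u)) * (y u * z u ^ n))
      (Set.Ioi t) := by
    have h := ((integrableOn_exp_mul_Ioi (a := -lam) (by linarith) t).const_mul lam).const_mul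
      ((n : ℝ) + 1)
    have hm := hcont.measurable
    refine Integrable.mono' h (by fun_prop) ?_
    refine (ae_restrict_iff' measurableSet_Ioi).2 (ae_of_all _ fun u hu => ?_)
    have hu0 : 0 ≤ u := ht.trans (le_of_lt hu)
    have hz0 : 0 ≤ z u := discountedTail_nonneg hlam h0 u
    have hz1 : z u ≤ 1 := discountedTail_le_one hlam hy h0 h1 hu0
    have hy0 := h0 u
    rw [Real.norm_of_nonneg (by positivity)]
    exact mul_le_of_le_one_right (by positivity)
      (mul_le_one₀ (h1 u) (by positivity) (pow_le_one₀ hz0 hz1))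
  have hlim := intervalIntegral_tendsto_integral_Ioi t hint Filter.tendsto_id
  have hpow : Filter.Tendsto (fun s => z t ^ (n + 1) - z s ^ (n + 1)) Filter.atTop
      (nhds (z t ^ (n + 1))) := by
    simpa using ((tendsto_discountedTail hlam hy h0 h1).pow (n + 1)).const_sub (z t ^ (n + 1))
  refine tendsto_nhds_unique hpow (hlim.congr' ?_)
  filter_upwards [Filter.eventually_ge_atTop t] with s hs
  -- The fundamental theorem of calculus for `-z ^ (n + 1)` on `[t, s]` needs only continuity and a
  -- right derivative; the boundary term at `s` vanishes as `s → ∞`.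
  have := intervalIntegral.integral_eq_sub_of_hasDeriv_right_of_le (f := fun u => -z u ^ (n + 1))
    (f' := fun u => (n + 1) * (lam * Real.exp (-lam * u)) * (y u * z u ^ n)) hs
    (by fun_prop) (fun u hu => ?_) ?_
  · rw [id, this]; ring
  · have hd := ((hasDerivWithinAt_discountedTail hlam hy hb (hc u (ht.trans hu.1.le))).pow
      (n + 1)).neg
    refine hd.congr_deriv ?_
    push_cast
    rw [hz]
    ring
  · rw [intervalIntegrable_iff_integrableOn_Ioc_of_le hs]
    exact hint.mono_set fun u hu => hu.1

end DiscountedTail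

/-! ### Transition probabilities -/

theorem twoStateTransition_eq {α β : ℝ} (hα : 0 < α) (hβ : 0 < β) (t : ℝ≥0) :
    twoStateTransition α β t =
      !![(β + α * Real.exp (-(α + β) * t)) / (α + β), (α - α * Real.exp (-(α + β) * t)) / (α + β);
        (β - β * Real.exp (-(α + β) * t)) / (α + β),
        (α + β * Real.exp (-(α + β) * t)) / (α + β)] := by
  have hs : α + β ≠ 0 := by positivity
  -- The columns are eigenvectors of the generator for the eigenvalues `0` and `-(α + β)`.
  let U : Matrix (Fin 2) (Fin 2) ℝ := !![1, α; 1, -β]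
  have hdet : U.det = -(α + β) := by simp [U, Matrix.det_fin_two]; ring
  have hU : IsUnit U := by
    rw [Matrix.isUnit_iff_isUnit_det, hdet]
    exact (neg_ne_zero.2 hs).isUnit
  have hinv : U⁻¹ = (α + β)⁻¹ • !![β, α; 1, -1] := by
    refine Matrix.inv_eq_right_inv ?_
    ext i j
    fin_cases i <;> fin_cases j <;> simp [U, Matrix.mul_apply, Fin.sum_univ_two] <;> field_simp <;>
      ring
  have hG : (t : ℝ) • twoStateGenerator α β =
      U * Matrix.diagonal ![0, -(α + β) * t] * U⁻¹ := by
    rw [hinv]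
    ext i j
    rw [Matrix.mul_apply, Fin.sum_univ_two, Matrix.mul_diagonal, Matrix.mul_diagonal]
    fin_cases i <;> fin_cases j <;> simp [U, twoStateGenerator] <;> field_simp <;>
      ring
  rw [twoStateTransition, hG, Matrix.exp_conj _ _ hU, Matrix.exp_diagonal, hinv]
  ext i j
  rw [Matrix.mul_apply, Fin.sum_univ_two, Matrix.mul_diagonal, Matrix.mul_diagonal,
    Pi.coe_exp]
  fin_cases i <;> fin_cases j <;> simp [U, Real.exp_eq_exp_ℝ] <;> field_simp <;> ring

/-! ### Moments on the unit interval and Beta laws -/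

/-- Two probability measures on `[0, 1]` with the same moments coincide. -/
theorem measure_eq_of_moments_eq (μ ν : Measure ℝ) [IsProbabilityMeasure μ]
    [IsProbabilityMeasure ν] (hμ : ∀ᵐ x ∂μ, x ∈ Set.Icc (0 : ℝ) 1)
    (hν : ∀ᵐ x ∂ν, x ∈ Set.Icc (0 : ℝ) 1) (h : ∀ n : ℕ, ∫ x, x ^ n ∂μ = ∫ x, x ^ n ∂ν) :
    μ = ν := by
  have hpint : ∀ (κ : Measure ℝ) [IsProbabilityMeasure κ], (∀ᵐ x ∂κ, x ∈ Set.Icc (0 : ℝ) 1) →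
      ∀ n : ℕ, Integrable (fun x : ℝ => x ^ n) κ := by
    intro κ _ hκ n
    refine Integrable.mono' (integrable_const (1 : ℝ)) (by fun_prop) ?_
    filter_upwards [hκ] with x hx
    rw [Real.norm_of_nonneg (pow_nonneg hx.1 n)]
    exact pow_le_one₀ hx.1 hx.2
  have hpoly : ∀ (κ : Measure ℝ) [IsProbabilityMeasure κ], (∀ᵐ x ∂κ, x ∈ Set.Icc (0 : ℝ) 1) →
      ∀ p : Polynomial ℝ, Integrable (fun x => p.eval x) κ ∧
        ∫ x, p.eval x ∂κ = ∑ n ∈ Finset.range (p.natDegree + 1), p.coeff n * ∫ x, x ^ n ∂κ := by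
    intro κ _ hκ p
    have hi := fun n => (hpint κ hκ n).const_mul (p.coeff n)
    simp_rw [Polynomial.eval_eq_sum_range]
    refine ⟨integrable_finsetSum _ fun n _ => hi n, ?_⟩
    rw [integral_finsetSum _ fun n _ => hi n]
    simp_rw [integral_const_mul]
  have happrox : ∀ (κ : Measure ℝ) [IsProbabilityMeasure κ], (∀ᵐ x ∂κ, x ∈ Set.Icc (0 : ℝ) 1) →
      ∀ (f : BoundedContinuousFunction ℝ ℝ) (p : Polynomial ℝ) (ε : ℝ),
      (∀ x ∈ Set.Icc (0 : ℝ) 1, |p.eval x - f x| < ε) →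
        |∫ x, p.eval x ∂κ - ∫ x, f x ∂κ| ≤ ε := by
    intro κ _ hκ f p ε hp
    rw [← integral_sub (hpoly κ hκ p).1 (f.integrable κ)]
    have := norm_integral_le_of_norm_le_const (μ := κ) (f := fun x => p.eval x - f x) (C := ε) (by
      filter_upwards [hκ] with x hx
      exact (hp x hx).le)
    simpa using this
  refine ext_of_forall_integral_eq_of_IsFiniteMeasure fun f => ?_
  refine eq_of_forall_dist_le fun ε hε => ?_
  -- Weierstrass: polynomial integrals agree under both measures, and each replacement of `f` by `p`
  -- costs at most `ε / 2`.
  obtain ⟨p, hp⟩ := exists_polynomial_near_of_continuousOn 0 1 f f.continuous.continuousOn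
    (ε / 2) (by linarith)
  have h1 := happrox μ hμ f p _ hp
  have h2 := happrox ν hν f p _ hp
  have h3 : ∫ x, p.eval x ∂μ = ∫ x, p.eval x ∂ν := by
    rw [(hpoly μ hμ p).2, (hpoly ν hν p).2]
    simp_rw [h]
  rw [h3] at h1
  rw [Real.dist_eq]
  rw [abs_le] at *
  constructor <;> linarith [h1.1, h1.2, h2.1, h2.2]

section BetaMoments

theorem beta_add_one_left {a b : ℝ} (ha : 0 < a) (hb : 0 < b) :
    beta (a + 1) b = beta a b * (a / (a + b)) := by
  have h1 : a + b ≠ 0 := by positivity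
  have h2 : Real.Gamma (a + b) ≠ 0 := (Real.Gamma_pos_of_pos (by positivity)).ne'
  rw [beta, beta, Real.Gamma_add_one ha.ne', show a + 1 + b = (a + b) + 1 by ring,
    Real.Gamma_add_one h1]
  field_simp

theorem beta_add_one_right {a b : ℝ} (ha : 0 < a) (hb : 0 < b) :
    beta a (b + 1) = beta a b * (b / (a + b)) := by
  have h1 : a + b ≠ 0 := by positivity
  have h2 : Real.Gamma (a + b) ≠ 0 := (Real.Gamma_pos_of_pos (by positivity)).ne'
  rw [beta, beta, Real.Gamma_add_one hb.ne', show a + (b + 1) = (a + b) + 1 by ring,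
    Real.Gamma_add_one h1]
  field_simp

theorem betaPDFReal_nonneg {a b : ℝ} (ha : 0 < a) (hb : 0 < b) (x : ℝ) :
    0 ≤ betaPDFReal a b x := by
  by_cases hx : 0 < x ∧ x < 1
  · exact (betaPDFReal_pos hx.1 hx.2 ha hb).le
  · rw [betaPDFReal, if_neg hx]

theorem integral_betaPDFReal {a b : ℝ} (ha : 0 < a) (hb : 0 < b) :
    ∫ x, betaPDFReal a b x = 1 := by
  rw [integral_eq_lintegral_of_nonneg_ae (ae_of_all _ (betaPDFReal_nonneg ha hb))
    (by fun_prop)]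
  change (∫⁻ x, betaPDF a b x).toReal = 1
  rw [lintegral_betaPDF_eq_one ha hb, ENNReal.toReal_one]

theorem ae_betaMeasure_mem_Icc (a b : ℝ) : ∀ᵐ x ∂betaMeasure a b, x ∈ Set.Icc (0 : ℝ) 1 := by
  have hm : Measurable (betaPDF a b) := (measurable_betaPDFReal a b).ennreal_ofReal
  rw [betaMeasure, ae_withDensity_iff hm]
  refine ae_of_all _ fun x hx => ⟨?_, ?_⟩ <;> by_contra! h
  · exact hx (betaPDF_eq_zero_of_nonpos h.le)
  · exact hx (betaPDF_eq_zero_of_one_le h.le)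

/-- Multiplying the `Beta(a, b)` density by `x ^ n` gives a multiple of the `Beta(a + n, b)`
density. -/
theorem integral_pow_betaMeasure {a b : ℝ} (ha : 0 < a) (hb : 0 < b) (n : ℕ) :
    ∫ x, x ^ n ∂betaMeasure a b = beta (a + n) b / beta a b := by
  have hm : Measurable (betaPDF a b) := (measurable_betaPDFReal a b).ennreal_ofReal
  rw [betaMeasure, integral_withDensity_eq_integral_toReal_smul hm
    (ae_of_all _ fun x => ENNReal.ofReal_lt_top)]
  have hn : 0 < a + n := by positivity
  have h1 := (beta_pos ha hb).ne'
  have h2 := (beta_pos hn hb).ne'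
  have : ∀ x, (betaPDF a b x).toReal • x ^ n =
      beta (a + n) b / beta a b * betaPDFReal (a + n) b x := by
    intro x
    rw [betaPDF, ENNReal.toReal_ofReal (betaPDFReal_nonneg ha hb x), smul_eq_mul]
    unfold betaPDFReal
    split_ifs with hx
    · rw [show a + n - 1 = (a - 1) + n by ring, Real.rpow_add hx.1, Real.rpow_natCast]
      field_simp
    · simp
  simp_rw [this]
  rw [integral_const_mul, integral_betaPDFReal hn hb, mul_one]

end BetaMoments

/-! ### Measurable versions of the indicator process -/

theorem measurable_uncurry_of_right_continuous {Ω : Type*} [MeasurableSpace Ω] {Y : ℝ → Ω → ℝ}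
    (hm : ∀ t, Measurable (Y t))
    (hc : ∀ ω t, ContinuousWithinAt (fun u => Y u ω) (Set.Ici t) t) :
    Measurable (Function.uncurry Y) := by
  -- The first point strictly after `t` of the grid of mesh `1 / (n + 1)`. Sampling there depends on
  -- time through an integer only, so it is jointly measurable, and it converges by
  -- right-continuity.
  let d : ℕ → ℝ → ℝ := fun n t => ((⌊((n : ℝ) + 1) * t⌋ : ℝ) + 1) / ((n : ℝ) + 1)
  have hd : ∀ t, Filter.Tendsto (fun n => d n t) Filter.atTop (nhdsWithin t (Set.Ici t)) := by
    intro t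
    have hge : ∀ n, t ≤ d n t := fun n => by
      rw [le_div_iff₀ (by positivity), mul_comm]
      exact (Int.lt_floor_add_one _).le
    have hle : ∀ n, d n t ≤ t + 1 / ((n : ℝ) + 1) := fun n => by
      have hn : (0 : ℝ) < (n : ℝ) + 1 := by positivity
      have h := Int.floor_le (((n : ℝ) + 1) * t)
      rw [div_le_iff₀ hn]
      calc _ ≤ ((n : ℝ) + 1) * t + 1 := by linarith
        _ = _ := by field_simp
    refine tendsto_nhdsWithin_iff.2 ⟨?_, Filter.Eventually.of_forall hge⟩
    refine tendsto_of_tendsto_of_tendsto_of_le_of_le tendsto_const_nhds ?_ hge hle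
    simpa using tendsto_one_div_add_atTop_nhds_zero_nat.const_add t
  refine measurable_of_tendsto_metrizable (f := fun n p => Y (d n p.1) p.2) (fun n => ?_) ?_
  · have h : Measurable fun q : ℤ × Ω => Y (((q.1 : ℝ) + 1) / ((n : ℝ) + 1)) q.2 :=
      measurable_from_prod_countable_right fun k => hm (((k : ℝ) + 1) / ((n : ℝ) + 1))
    have hf : Measurable fun p : ℝ × Ω => (⌊((n : ℝ) + 1) * p.1⌋, p.2) := by fun_prop
    exact h.comp hf
  · refine tendsto_pi_nhds.2 fun p => ?_
    exact (hc p.2 p.1).tendsto.comp (hd p.1)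

theorem measurable_historyUpTo {Ω : Type*} (μ : ℝ≥0 → Ω → ℝ) (s : ℝ≥0) : Measurable[historyUpTo μ s] (μ s) :=
  Measurable.of_comap_le (le_iSup₂_of_le s le_rfl le_rfl)

theorem historyUpTo_mono {Ω : Type*} (μ : ℝ≥0 → Ω → ℝ) {s t : ℝ≥0} (h : s ≤ t) :
    historyUpTo μ s ≤ historyUpTo μ t :=
  iSup₂_le fun r hr => le_iSup₂_of_le r (hr.trans h) le_rfl

theorem measurableSet_history_state {Ω : Type*} (μ : ℝ≥0 → Ω → ℝ) (s : ℝ≥0) {B : Set Ω}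
    (hB : MeasurableSet[historyUpTo μ s] B) (r : ℝ) :
    MeasurableSet[historyUpTo μ s] (B ∩ {ω | μ s ω = r}) :=
  MeasurableSet.inter hB (measurable_historyUpTo μ s (measurableSet_singleton r))

variable {Ω : Type*} [MeasurableSpace Ω] {P : Measure Ω} {ρ₁ ρ₂ α β lam : ℝ} {μ : ℝ≥0 → Ω → ℝ}

/-- `Y` is a jointly measurable, everywhere right-continuous version of the indicator process of
the upper state of `μ`. -/
structure IsUpperIndicator (P : Measure Ω) (ρ₁ ρ₂ : ℝ) (μ : ℝ≥0 → Ω → ℝ) (Y : ℝ → Ω → ℝ) :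
    Prop where
  measurable : Measurable (Function.uncurry Y)
  zero_or_one : ∀ t ω, Y t ω = 0 ∨ Y t ω = 1
  right_continuous : ∀ ω t, ContinuousWithinAt (fun u => Y u ω) (Set.Ici t) t
  ae_eq : ∀ᵐ ω ∂P, ∀ t : ℝ, Y t ω = (μ t.toNNReal ω - ρ₁) / (ρ₂ - ρ₁)

theorem IsTwoStateCTMC.exists_isUpperIndicator (hρ : ρ₁ < ρ₂)
    (hμ : IsTwoStateCTMC P ρ₁ ρ₂ α β μ) : ∃ Y, IsUpperIndicator P ρ₁ ρ₂ μ Y := by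
  obtain ⟨G, hGm, hGc, hG⟩ : ∃ G : Set Ω, MeasurableSet G ∧ P Gᶜ = 0 ∧
      ∀ ω ∈ G, ∀ t : ℝ≥0, ContinuousWithinAt (fun s => μ s ω) (Set.Ici t) t := by
    obtain ⟨N, hN, hNm, hN0⟩ := exists_measurable_superset_of_null
      (ae_iff.1 hμ.right_continuous)
    refine ⟨Nᶜ, hNm.compl, by simpa using hN0, fun ω hω => ?_⟩
    by_contra h
    exact hω (hN h)
  have hne : ρ₂ - ρ₁ ≠ 0 := (sub_pos.2 hρ).ne'
  -- Zeroing the paths outside a measurable set of full measure makes right-continuity hold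
  -- everywhere.
  let Y : ℝ → Ω → ℝ := fun t => G.indicator fun ω => (μ t.toNNReal ω - ρ₁) / (ρ₂ - ρ₁)
  have hc : ∀ ω t, ContinuousWithinAt (fun u => Y u ω) (Set.Ici t) t := by
    intro ω t
    by_cases hω : ω ∈ G
    · simp only [Y, Set.indicator_of_mem hω]
      refine ContinuousWithinAt.div_const (ContinuousWithinAt.sub ?_ continuousWithinAt_const) _
      exact (hG ω hω t.toNNReal).comp (continuous_real_toNNReal.continuousWithinAt)
        fun u hu => Real.toNNReal_le_toNNReal hu
    · simp only [Y, Set.indicator_of_notMem hω]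
      exact continuousWithinAt_const
  refine ⟨Y, measurable_uncurry_of_right_continuous (fun t => ?_) hc, fun t ω => ?_, hc, ?_⟩
  · exact (((hμ.measurable _).sub_const _).div_const _).indicator hGm
  · by_cases hω : ω ∈ G
    · simp only [Y, Set.indicator_of_mem hω]
      rcases hμ.state_space t.toNNReal ω with h | h <;> rw [h]
      · simp
      · exact Or.inr (div_self hne)
    · exact Or.inl (Set.indicator_of_notMem hω _)
  · filter_upwards [measure_eq_zero_iff_ae_notMem.1 hGc] with ω hω t
    exact Set.indicator_of_mem (by simpa using hω) _

/-- Conditional moments of the normalized perpetuity, given the initial state. -/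
def tailMoment (a b : ℝ) : ℕ → Fin 2 → ℝ
  | 0, _ => 1
  | n + 1, i => ![a, a + n + 1] i / (a + b + n + 1) * tailMoment a b n 1

namespace IsUpperIndicator

variable {Y : ℝ → Ω → ℝ}

theorem measurable_path (hY : IsUpperIndicator P ρ₁ ρ₂ μ Y) (ω : Ω) :
    Measurable fun t => Y t ω := hY.measurable.comp measurable_prodMk_right

theorem nonneg (hY : IsUpperIndicator P ρ₁ ρ₂ μ Y) (t : ℝ) (ω : Ω) : 0 ≤ Y t ω := by
  rcases hY.zero_or_one t ω with h | h <;> simp [h]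

theorem le_one (hY : IsUpperIndicator P ρ₁ ρ₂ μ Y) (t : ℝ) (ω : Ω) : Y t ω ≤ 1 := by
  rcases hY.zero_or_one t ω with h | h <;> simp [h]

theorem abs_le_one (hY : IsUpperIndicator P ρ₁ ρ₂ μ Y) (t : ℝ) (ω : Ω) : |Y t ω| ≤ 1 := by
  rw [abs_of_nonneg (hY.nonneg t ω)]; exact hY.le_one t ω

/-- Writing the moving lower limit as an indicator turns the tail into a parametric integral of a
jointly measurable function. -/
theorem measurable_discountedTail (hY : IsUpperIndicator P ρ₁ ρ₂ μ Y) (lam : ℝ) :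
    Measurable fun p : ℝ × Ω => discountedTail lam (fun u => Y u p.2) p.1 := by
  have h : ∀ p : ℝ × Ω, discountedTail lam (fun u => Y u p.2) p.1 =
      ∫ u, {q : (ℝ × Ω) × ℝ | q.1.1 < q.2}.indicator
        (fun q => lam * Real.exp (-lam * q.2) * Y q.2 q.1.2) (p, u) := by
    intro p
    rw [discountedTail, ← integral_indicator measurableSet_Ioi]
    rfl
  rw [funext h]
  have hYm : Measurable fun q : (ℝ × Ω) × ℝ => Y q.2 q.1.2 :=
    hY.measurable.comp (by fun_prop : Measurable fun q : (ℝ × Ω) × ℝ => (q.2, q.1.2))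
  have hm : Measurable ({q : (ℝ × Ω) × ℝ | q.1.1 < q.2}.indicator
      (fun q => lam * Real.exp (-lam * q.2) * Y q.2 q.1.2)) :=
    Measurable.indicator ((by fun_prop : Measurable fun q : (ℝ × Ω) × ℝ =>
      lam * Real.exp (-lam * q.2)).mul hYm) (measurableSet_lt (by fun_prop) (by fun_prop))
  exact (hm.stronglyMeasurable.integral_prod_right' (ν := volume)).measurable

theorem ae_eq_indicator (hρ : ρ₁ < ρ₂) (hμ : IsTwoStateCTMC P ρ₁ ρ₂ α β μ)
    (hY : IsUpperIndicator P ρ₁ ρ₂ μ Y) (t : ℝ) :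
    ∀ᵐ ω ∂P, Y t ω = {ω | μ t.toNNReal ω = ρ₂}.indicator 1 ω := by
  have hne : ρ₂ - ρ₁ ≠ 0 := (sub_pos.2 hρ).ne'
  filter_upwards [hY.ae_eq] with ω hω
  rw [hω t]
  rcases hμ.state_space t.toNNReal ω with h | h
  · simp [Set.indicator, h, hρ.ne]
  · simp [Set.indicator, h, hne]

end IsUpperIndicator

/-! ### The moment recursion -/

/-- The discounted integral of the transition probabilities into the upper state. -/
theorem integral_discounted_transition (hα : 0 < α) (hβ : 0 < β) (hlam : 0 < lam) (n : ℕ)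
    (t : ℝ) (i : Fin 2) :
    ∫ u in Set.Ioi t, (n + 1) * (lam * Real.exp (-lam * u)) *
        (twoStateTransition α β (u - t).toNNReal i 1 * Real.exp (-(n * lam) * u)) =
      Real.exp (-((n + 1 : ℕ) * lam) * t) *
        (![α / lam, α / lam + n + 1] i / (α / lam + β / lam + n + 1)) := by
  have hs : α + β ≠ 0 := by positivity
  -- One computation for both starting states: `p` is the stationary part, `q` the coefficient of
  -- the decaying exponential.
  have key : ∀ p q : ℝ, ∫ u in Set.Ioi t, (n + 1) * (lam * Real.exp (-lam * u)) *
        ((p + q * Real.exp (-(α + β) * (u - t))) / (α + β) * Real.exp (-(n * lam) * u)) =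
      Real.exp (-((n + 1 : ℕ) * lam) * t) * ((p + q * ((n + 1) * lam / ((n + 1) * lam + α + β)))
        / (α + β)) := by
    intro p q
    have h1 : -(((n : ℝ) + 1) * lam) < 0 := by
      have : 0 < ((n : ℝ) + 1) * lam := by positivity
      linarith
    have h2 : -(((n : ℝ) + 1) * lam + α + β) < 0 := by linarith
    have e : ∀ u : ℝ, (n + 1) * (lam * Real.exp (-lam * u)) *
        ((p + q * Real.exp (-(α + β) * (u - t))) / (α + β) * Real.exp (-(n * lam) * u)) =
        (n + 1) * lam * p / (α + β) * Real.exp (-(((n : ℝ) + 1) * lam) * u) +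
        (n + 1) * lam * q / (α + β) * Real.exp ((α + β) * t) *
          Real.exp (-(((n : ℝ) + 1) * lam + α + β) * u) := by
      intro u
      rw [show -(((n : ℝ) + 1) * lam) * u = -lam * u + -(n * lam) * u by ring,
        show -(((n : ℝ) + 1) * lam + α + β) * u =
          -lam * u + -(n * lam) * u + -(α + β) * u by ring,
        show -(α + β) * (u - t) = -(α + β) * u + (α + β) * t by ring]
      simp only [Real.exp_add]
      ring
    simp_rw [e]
    rw [integral_add ((integrableOn_exp_mul_Ioi h1 t).const_mul _)
      ((integrableOn_exp_mul_Ioi h2 t).const_mul _), integral_const_mul, integral_const_mul,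
      integral_exp_mul_Ioi h1, integral_exp_mul_Ioi h2,
      show -(((n : ℝ) + 1) * lam + α + β) * t =
        -(((n : ℝ) + 1) * lam) * t + -((α + β) * t) by ring, Real.exp_add, Real.exp_neg]
    have h3 : ((n : ℝ) + 1) * lam + α + β ≠ 0 := by positivity
    have h4 := (Real.exp_pos ((α + β) * t)).ne'
    push_cast
    field_simp
  have hcoe : Set.EqOn (fun u => (n + 1) * (lam * Real.exp (-lam * u)) *
        (twoStateTransition α β (u - t).toNNReal i 1 * Real.exp (-(n * lam) * u)))
      (fun u => (n + 1) * (lam * Real.exp (-lam * u)) *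
        ((α + ![-α, β] i * Real.exp (-(α + β) * (u - t))) / (α + β) *
          Real.exp (-(n * lam) * u))) (Set.Ioi t) := by
    intro u hu
    have : ((u - t).toNNReal : ℝ) = u - t := Real.coe_toNNReal _ (sub_nonneg.2 (le_of_lt hu))
    simp only [twoStateTransition_eq hα hβ, this]
    fin_cases i
    · simp
      left
      ring
    · simp
  rw [setIntegral_congr_fun measurableSet_Ioi hcoe, key]
  congr 1
  have h3 : ((n : ℝ) + 1) * lam + α + β ≠ 0 := by positivity
  have h4 : α / lam + β / lam + n + 1 ≠ 0 := by positivity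
  fin_cases i <;> simp <;> field_simp <;> ring

/-- Quantifying over all times and all past events makes the induction close: the event at time `t`
is again a past event at every later time `u`. -/
theorem integral_discountedTail_pow [IsProbabilityMeasure P] (hρ : ρ₁ < ρ₂) (hα : 0 < α)
    (hβ : 0 < β) (hlam : 0 < lam) (hμ : IsTwoStateCTMC P ρ₁ ρ₂ α β μ) {Y : ℝ → Ω → ℝ}
    (hY : IsUpperIndicator P ρ₁ ρ₂ μ Y) (n : ℕ) :
    ∀ (t : ℝ≥0) (B : Set Ω), MeasurableSet[historyUpTo μ t] B → ∀ i : Fin 2,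
      ∫ ω in B ∩ {ω | μ t ω = ![ρ₁, ρ₂] i}, discountedTail lam (fun u => Y u ω) t ^ n ∂P =
        P.real (B ∩ {ω | μ t ω = ![ρ₁, ρ₂] i}) *
          (Real.exp (-(n * lam) * t) * tailMoment (α / lam) (β / lam) n i) := by
  induction n with
  | zero => intro t B _ i; simp [tailMoment]
  | succ n ih =>
    intro t B hB i
    have ht := NNReal.coe_nonneg t
    have hE := measurableSet_history_state μ t hB (![ρ₁, ρ₂] i)
    set E := B ∩ {ω | μ t ω = ![ρ₁, ρ₂] i} with hE_def
    have hZm := hY.measurable_discountedTail lam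
    have hpath : ∀ ω, discountedTail lam (fun u => Y u ω) t ^ (n + 1) =
        ∫ u in Set.Ioi (t : ℝ), (n + 1) * (lam * Real.exp (-lam * u)) *
          (Y u ω * discountedTail lam (fun u => Y u ω) u ^ n) := fun ω =>
      discountedTail_pow_succ hlam (hY.measurable_path ω) (hY.nonneg · ω) (hY.le_one · ω)
        (fun s _ => hY.right_continuous ω s) n ht
    simp_rw [hpath]
    -- Fubini applies by domination with `(n + 1) lam e^{-lam u}`, as `Y` and the tail lie in `[0,
    -- 1]`.
    have hint : Integrable (Function.uncurry fun (ω : Ω) (u : ℝ) =>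
        (n + 1) * (lam * Real.exp (-lam * u)) *
          (Y u ω * discountedTail lam (fun u => Y u ω) u ^ n))
        ((P.restrict E).prod (volume.restrict (Set.Ioi (t : ℝ)))) := by
      have hbound : Integrable (fun q : Ω × ℝ => (n + 1) * (lam * Real.exp (-lam * q.2)))
          ((P.restrict E).prod (volume.restrict (Set.Ioi (t : ℝ)))) := by
        have h := ((integrableOn_exp_mul_Ioi (a := -lam) (by linarith) t).const_mul
          lam).const_mul ((n : ℝ) + 1)
        exact h.comp_snd _
      refine Integrable.mono' hbound ?_ ?_
      · have h1 : Measurable fun q : Ω × ℝ => Y q.2 q.1 := hY.measurable.comp measurable_swap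
        have h2 : Measurable fun q : Ω × ℝ => discountedTail lam (fun u => Y u q.1) q.2 :=
          hZm.comp measurable_swap
        have h3 : Measurable fun q : Ω × ℝ => (n + 1) * (lam * Real.exp (-lam * q.2)) *
          (Y q.2 q.1 * discountedTail lam (fun u => Y u q.1) q.2 ^ n) :=
          Measurable.mul (by fun_prop) (h1.mul (h2.pow_const n))
        exact h3.aestronglyMeasurable
      · have hae : ∀ᵐ q ∂((P.restrict E).prod (volume.restrict (Set.Ioi (t : ℝ)))),
            q.2 ∈ Set.Ioi (t : ℝ) :=
          Measure.quasiMeasurePreserving_snd.ae (ae_restrict_mem measurableSet_Ioi)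
        filter_upwards [hae] with q hq
        have hq0 : 0 ≤ q.2 := ht.trans (le_of_lt hq)
        have hz0 := discountedTail_nonneg hlam (hY.nonneg · q.1) q.2
        have hz1 := discountedTail_le_one hlam (hY.measurable_path q.1) (hY.nonneg · q.1)
          (hY.le_one · q.1) hq0
        have hy0 := hY.nonneg q.2 q.1
        simp only [Function.uncurry]
        rw [Real.norm_of_nonneg (by positivity)]
        exact mul_le_of_le_one_right (by positivity)
          (mul_le_one₀ (hY.le_one _ _) (by positivity) (pow_le_one₀ hz0 hz1))
    rw [integral_integral_swap hint]
    have hinner : Set.EqOn (fun u => ∫ ω in E, (n + 1) * (lam * Real.exp (-lam * u)) *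
          (Y u ω * discountedTail lam (fun u => Y u ω) u ^ n) ∂P)
        (fun u => P.real E * tailMoment (α / lam) (β / lam) n 1 *
          ((n + 1) * (lam * Real.exp (-lam * u)) *
            (twoStateTransition α β (u - t).toNNReal i 1 * Real.exp (-(n * lam) * u))))
        (Set.Ioi (t : ℝ)) := by
      intro u hu
      have hu' : (t : ℝ) < u := hu
      have hu0 : 0 ≤ u := ht.trans hu'.le
      have hcoe : (u.toNNReal : ℝ) = u := Real.coe_toNNReal u hu0
      have htu : t ≤ u.toNNReal := NNReal.coe_le_coe.1 (by rw [hcoe]; exact hu'.le)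
      have hadd : t + (u - t).toNNReal = u.toNNReal := by
        rw [← NNReal.coe_inj, NNReal.coe_add, hcoe, Real.coe_toNNReal _ (by linarith)]
        ring
      have hmark := hμ.markov t (u - t).toNNReal B hB i 1
      rw [hadd] at hmark
      -- Only the upper state at time `u` is needed, since `Y u` vanishes on the lower one.
      have hih := ih u.toNNReal E (historyUpTo_mono μ htu _ hE) 1
      simp only [Matrix.cons_val_one, Matrix.cons_val_fin_one] at hmark hih
      rw [hcoe] at hih
      have hmeas : MeasurableSet {ω | μ u.toNNReal ω = ρ₂} :=
        hμ.measurable _ (measurableSet_singleton ρ₂)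
      have hind : ∫ ω in E, Y u ω * discountedTail lam (fun u => Y u ω) u ^ n ∂P =
          ∫ ω in E ∩ {ω | μ u.toNNReal ω = ρ₂}, discountedTail lam (fun u => Y u ω) u ^ n ∂P := by
        rw [← setIntegral_indicator hmeas]
        refine integral_congr_ae (ae_restrict_of_ae ?_)
        filter_upwards [hY.ae_eq_indicator hρ hμ u] with ω hω
        rw [hω]
        by_cases h : ω ∈ {ω | μ u.toNNReal ω = ρ₂} <;> simp only [Set.indicator, h] <;> simp
      simp only
      rw [integral_const_mul, hind, hih, hmark]
      ring
    rw [setIntegral_congr_fun measurableSet_Ioi hinner, integral_const_mul,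
      integral_discounted_transition hα hβ hlam n t i, tailMoment]
    ring

/-- From the upper state the recursion is closed, and its factor is the ratio of successive moments
of `Beta(a + 1, b)`. -/
theorem tailMoment_one {a b : ℝ} (ha : 0 < a) (hb : 0 < b) (n : ℕ) :
    tailMoment a b n 1 = beta (a + 1 + n) b / beta (a + 1) b := by
  induction n with
  | zero => simp [tailMoment, div_self (beta_pos (by positivity : 0 < a + 1) hb).ne']
  | succ n ih =>
    rw [tailMoment, ih, Nat.cast_succ, ← add_assoc,
      beta_add_one_left (by positivity : 0 < a + 1 + n) hb]
    have h1 := (beta_pos (by positivity : 0 < a + 1) hb).ne'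
    have h2 : a + 1 + n + b ≠ 0 := by positivity
    have h3 : a + b + n + 1 ≠ 0 := by positivity
    simp only [Matrix.cons_val_one, Matrix.cons_val_fin_one]
    field_simp
    ring

/-- One step from the lower state leads to the upper sequence; shifting the Beta parameters does the
rest. -/
theorem tailMoment_zero {a b : ℝ} (ha : 0 < a) (hb : 0 < b) (n : ℕ) :
    tailMoment a b n 0 = beta (a + n) (b + 1) / beta a (b + 1) := by
  cases n with
  | zero => simp [tailMoment, div_self (beta_pos ha (by positivity : 0 < b + 1)).ne']
  | succ n =>
    rw [tailMoment, tailMoment_one ha hb, Nat.cast_succ,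
      beta_add_one_right (by positivity : 0 < a + ((n : ℝ) + 1)) hb, beta_add_one_right ha hb,
      beta_add_one_left ha hb, show a + 1 + (n : ℝ) = a + (n + 1) by ring]
    have h1 := (beta_pos ha hb).ne'
    have h2 : a + (n + 1) + b ≠ 0 := by positivity
    have h3 : a + b + n + 1 ≠ 0 := by positivity
    simp only [Matrix.cons_val_zero]
    field_simp
    ring

/-! ### Scaled Beta distribution functions and constants -/

section ScaledBeta

variable {ρ₁ ρ₂ lam a b : ℝ}

theorem betaMeasure_real_Iic (ha : 0 < a) (hb : 0 < b) {y : ℝ} (hy : 0 ≤ y) :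
    (betaMeasure a b).real (Set.Iic y) = ∫ z in (0 : ℝ)..y, betaPDFReal a b z := by
  rw [betaMeasure, measureReal_def, withDensity_apply _ measurableSet_Iic,
    ← Set.Iic_union_Ioc_eq_Iic hy, lintegral_union measurableSet_Ioc
      (Set.Iic_disjoint_Ioc le_rfl),
    setLIntegral_eq_zero measurableSet_Iic (fun x hx => betaPDF_eq_zero_of_nonpos hx), zero_add,
    intervalIntegral.integral_of_le hy,
    integral_eq_lintegral_of_nonneg_ae (ae_of_all _ (betaPDFReal_nonneg ha hb))
      (by fun_prop)]
  rfl

theorem scaledBeta_real_Iic (hρ : ρ₁ < ρ₂) (hlam : 0 < lam) (x : ℝ) :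
    (scaledBeta ρ₁ ρ₂ lam a b).real (Set.Iic x) =
      (betaMeasure a b).real (Set.Iic ((lam * x - ρ₁) / (ρ₂ - ρ₁))) := by
  have hΔ := sub_pos.2 hρ
  rw [scaledBeta, map_measureReal_apply (by fun_prop) measurableSet_Iic]
  congr 1
  ext y
  simp only [Set.mem_preimage, Set.mem_Iic]
  rw [div_le_iff₀ hlam, le_div_iff₀ hΔ]
  constructor <;> intro h <;> linarith

/-- Substitute `y = (lam z - ρ₁) / (ρ₂ - ρ₁)`. The exponent `a + b - 1` collects `a - 1` and `b - 1`
from the density and `1` from the Jacobian. -/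
theorem scaledBeta_real_Iic_eq_integral (hρ : ρ₁ < ρ₂) (hlam : 0 < lam) (ha : 0 < a) (hb : 0 < b)
    {x : ℝ} (hx₁ : ρ₁ / lam < x) (hx₂ : x < ρ₂ / lam) :
    (scaledBeta ρ₁ ρ₂ lam a b).real (Set.Iic x) =
      lam / ((ρ₂ - ρ₁) ^ (a + b - 1) * beta a b) *
        ∫ z in (ρ₁ / lam)..x, (lam * z - ρ₁) ^ (a - 1) * (ρ₂ - lam * z) ^ (b - 1) := by
  have hΔ := sub_pos.2 hρ
  have hx₁' : ρ₁ < x * lam := (div_lt_iff₀ hlam).1 hx₁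
  have hx₂' : x * lam < ρ₂ := (lt_div_iff₀ hlam).1 hx₂
  rw [scaledBeta_real_Iic hρ hlam, betaMeasure_real_Iic ha hb
    (div_nonneg (by linarith) hΔ.le)]
  have hc : lam / (ρ₂ - ρ₁) ≠ 0 := (div_pos hlam hΔ).ne'
  have hsub := intervalIntegral.integral_comp_mul_sub (a := ρ₁ / lam) (b := x)
    (betaPDFReal a b) hc (ρ₁ / (ρ₂ - ρ₁))
  rw [show lam / (ρ₂ - ρ₁) * (ρ₁ / lam) - ρ₁ / (ρ₂ - ρ₁) = 0 by field_simp; ring,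
    show lam / (ρ₂ - ρ₁) * x - ρ₁ / (ρ₂ - ρ₁) = (lam * x - ρ₁) / (ρ₂ - ρ₁) by field_simp,
    smul_eq_mul, eq_inv_mul_iff_mul_eq₀ hc] at hsub
  have hβ := (beta_pos ha hb).ne'
  rw [← hsub, ← intervalIntegral.integral_const_mul, ← intervalIntegral.integral_const_mul]
  refine intervalIntegral.integral_congr_ae (ae_of_all _ fun z hz => ?_)
  rw [Set.uIoc_of_le hx₁.le] at hz
  have hz₁ : 0 < lam * z - ρ₁ := by linarith [(div_lt_iff₀ hlam).1 hz.1]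
  have hz₂ : 0 < ρ₂ - lam * z := by nlinarith [hz.2]
  have e₁ : lam / (ρ₂ - ρ₁) * z - ρ₁ / (ρ₂ - ρ₁) = (lam * z - ρ₁) / (ρ₂ - ρ₁) := by field_simp
  have e₂ : 1 - (lam * z - ρ₁) / (ρ₂ - ρ₁) = (ρ₂ - lam * z) / (ρ₂ - ρ₁) := by field_simp; ring
  have hpos : 0 < (lam * z - ρ₁) / (ρ₂ - ρ₁) ∧ (lam * z - ρ₁) / (ρ₂ - ρ₁) < 1 :=
    ⟨div_pos hz₁ hΔ, (div_lt_one hΔ).2 (by linarith)⟩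
  rw [e₁, betaPDFReal, if_pos hpos, e₂, Real.div_rpow hz₁.le hΔ.le, Real.div_rpow hz₂.le hΔ.le,
    show a + b - 1 = (a - 1) + (b - 1) + 1 by ring, Real.rpow_add hΔ, Real.rpow_add hΔ,
    Real.rpow_one]
  have h₁ := (Real.rpow_pos_of_pos hΔ (a - 1)).ne'
  have h₂ := (Real.rpow_pos_of_pos hΔ (b - 1)).ne'
  field_simp

end ScaledBeta

theorem limitConst_eq {ρ₁ ρ₂ α β lam : ℝ} (hα : 0 < α) (hβ : 0 < β) (hlam : 0 < lam) :
    limitConst ρ₁ ρ₂ α β lam =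
      lam / ((ρ₂ - ρ₁) ^ (α / lam + (β / lam + 1) - 1) * beta (α / lam) (β / lam + 1)) := by
  have hg := (Real.Gamma_pos_of_pos (by positivity : 0 < α / lam + (β / lam + 1))).ne'
  rw [limitConst, beta, Real.Gamma_add_one (by positivity : β / lam ≠ 0),
    show (α + β + lam) / lam = α / lam + (β / lam + 1) by field_simp; ring,
    show α / lam + (β / lam + 1) - 1 = (α + β) / lam by field_simp; ring]
  field_simp

/-- The factor `β / α` is the ratio of `beta a (b + 1)` to `beta (a + 1) b` at `a = α / lam`, `b = β
/ lam`. -/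
theorem limitConst_mul_div_eq {ρ₁ ρ₂ α β lam : ℝ} (hα : 0 < α) (hβ : 0 < β) (hlam : 0 < lam) :
    β * limitConst ρ₁ ρ₂ α β lam / α =
      lam / ((ρ₂ - ρ₁) ^ (α / lam + 1 + β / lam - 1) * beta (α / lam + 1) (β / lam)) := by
  have h1 := (beta_pos (by positivity : 0 < α / lam) (by positivity : 0 < β / lam)).ne'
  rw [limitConst_eq hα hβ hlam, beta_add_one_left (by positivity) (by positivity),
    beta_add_one_right (by positivity) (by positivity),
    show α / lam + (β / lam + 1) - 1 = α / lam + 1 + β / lam - 1 by ring]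
  field_simp

/-! ### The conditional laws of the perpetuity -/

variable {Ω : Type*} [MeasurableSpace Ω] {P : Measure Ω} {ρ₁ ρ₂ α β lam : ℝ} {μ : ℝ≥0 → Ω → ℝ}
  {Y : ℝ → Ω → ℝ}

namespace IsUpperIndicator

theorem ae_integrableOn_discounted (hρ : ρ₁ < ρ₂) (hlam : 0 < lam)
    (hY : IsUpperIndicator P ρ₁ ρ₂ μ Y) :
    ∀ᵐ ω ∂P, IntegrableOn (fun s : ℝ => Real.exp (-lam * s) * μ s.toNNReal ω) (Set.Ioi 0) ∧
      perpetuity lam μ ω = (ρ₁ + (ρ₂ - ρ₁) * discountedTail lam (fun u => Y u ω) 0) / lam := by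
  have hΔ := (sub_pos.2 hρ).ne'
  filter_upwards [hY.ae_eq] with ω hω
  have e : (fun s : ℝ => Real.exp (-lam * s) * μ s.toNNReal ω) = fun s =>
      ρ₁ * Real.exp (-lam * s) +
        (ρ₂ - ρ₁) / lam * (lam * Real.exp (-lam * s) * Y s ω) := by
    funext s
    rw [hω s]
    field_simp
    ring
  have h1 := (integrableOn_exp_mul_Ioi (a := -lam) (by linarith) 0).const_mul ρ₁
  have h2 := (integrableOn_discounted hlam (hY.measurable_path ω) (hY.abs_le_one · ω) 0).const_mul
    ((ρ₂ - ρ₁) / lam)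
  refine ⟨by rw [e]; exact h1.add h2, ?_⟩
  rw [perpetuity, e, integral_add h1 h2, integral_const_mul, integral_const_mul,
    integral_exp_mul_Ioi (by linarith), ← discountedTail]
  simp
  field_simp

/-- Conditionally on the initial state, the normalized perpetuity is Beta distributed. -/
theorem map_discountedTail_cond [IsProbabilityMeasure P] (hρ : ρ₁ < ρ₂) (hα : 0 < α)
    (hβ : 0 < β) (hlam : 0 < lam) (hμ : IsTwoStateCTMC P ρ₁ ρ₂ α β μ)
    (hY : IsUpperIndicator P ρ₁ ρ₂ μ Y) (i : Fin 2)
    (hi : P.real {ω | μ 0 ω = ![ρ₁, ρ₂] i} ≠ 0) {a b : ℝ} (ha : 0 < a) (hb : 0 < b)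
    (hab : ∀ n : ℕ, tailMoment (α / lam) (β / lam) n i = beta (a + n) b / beta a b) :
    (P[|{ω | μ 0 ω = ![ρ₁, ρ₂] i}]).map (fun ω => discountedTail lam (fun u => Y u ω) 0) =
      betaMeasure a b := by
  have hm : Measurable fun ω => discountedTail lam (fun u => Y u ω) 0 :=
    (hY.measurable_discountedTail lam).comp measurable_prodMk_left
  have hP : IsProbabilityMeasure (P[|{ω | μ 0 ω = ![ρ₁, ρ₂] i}]) :=
    cond_isProbabilityMeasure fun h => hi (by rw [measureReal_def, h, ENNReal.toReal_zero])
  have := Measure.isProbabilityMeasure_map (μ := P[|{ω | μ 0 ω = ![ρ₁, ρ₂] i}]) hm.aemeasurable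
  have := isProbabilityMeasureBeta ha hb
  refine measure_eq_of_moments_eq _ _ ?_ (ae_betaMeasure_mem_Icc a b) fun n => ?_
  · refine (ae_map_iff hm.aemeasurable measurableSet_Icc).2 (ae_of_all _ fun ω => ⟨?_, ?_⟩)
    · exact discountedTail_nonneg hlam (hY.nonneg · ω) 0
    · exact discountedTail_le_one hlam (hY.measurable_path ω) (hY.nonneg · ω) (hY.le_one · ω) le_rfl
  · rw [integral_map hm.aemeasurable (by fun_prop), integral_pow_betaMeasure ha hb, ← hab,
      ProbabilityTheory.cond, integral_smul_measure]
    -- At time `0` with the trivial past event the exponential factor is `1`, and conditioning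
    -- cancels the probability of the initial state.
    have h := integral_discountedTail_pow hρ hα hβ hlam hμ hY n 0 Set.univ
      MeasurableSet.univ i
    simp only [Set.univ_inter, NNReal.coe_zero, mul_zero, Real.exp_zero, one_mul] at h
    rw [h, ENNReal.toReal_inv, smul_eq_mul, ← measureReal_def, inv_mul_cancel_left₀ hi]

theorem perpetuityCDFGiven_eq [IsProbabilityMeasure P] (hρ : ρ₁ < ρ₂) (hα : 0 < α)
    (hβ : 0 < β) (hlam : 0 < lam) (hμ : IsTwoStateCTMC P ρ₁ ρ₂ α β μ)
    (hY : IsUpperIndicator P ρ₁ ρ₂ μ Y) (i : Fin 2)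
    (hi : P.real {ω | μ 0 ω = ![ρ₁, ρ₂] i} ≠ 0) {a b : ℝ} (ha : 0 < a) (hb : 0 < b)
    (hab : ∀ n : ℕ, tailMoment (α / lam) (β / lam) n i = beta (a + n) b / beta a b) (x : ℝ) :
    perpetuityCDFGiven P lam μ (![ρ₁, ρ₂] i) x =
      (scaledBeta ρ₁ ρ₂ lam a b).real (Set.Iic x) := by
  have hm : Measurable fun ω => discountedTail lam (fun u => Y u ω) 0 :=
    (hY.measurable_discountedTail lam).comp measurable_prodMk_left
  rw [scaledBeta, ← hY.map_discountedTail_cond hρ hα hβ hlam hμ i hi ha hb hab,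
    Measure.map_map (by fun_prop) hm, map_measureReal_apply (by fun_prop) measurableSet_Iic,
    perpetuityCDFGiven]
  refine measureReal_congr ?_
  -- The affine identity holds only almost surely, and passes to the conditional measure by absolute
  -- continuity.
  have h := (cond_absolutelyContinuous (μ := P) (s := {ω | μ 0 ω = ![ρ₁, ρ₂] i})).ae_le
    (hY.ae_integrableOn_discounted hρ hlam)
  filter_upwards [h] with ω hω
  exact congrArg (· ≤ x) hω.2

end IsUpperIndicator

end

theorem mainTheorem12 {Ω : Type*} [MeasurableSpace Ω] (P : Measure Ω) [IsProbabilityMeasure P]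
    (ρ₁ ρ₂ α β lam : ℝ) (hρ : ρ₁ < ρ₂) (hα : 0 < α) (hβ : 0 < β) (hlam : 0 < lam)
    (μ : ℝ≥0 → Ω → ℝ) (hμ : IsTwoStateCTMC P ρ₁ ρ₂ α β μ)
    (h₁ : P.real {ω | μ 0 ω = ρ₁} = β / (α + β))
    (h₂ : P.real {ω | μ 0 ω = ρ₂} = α / (α + β)) :
    -- the perpetuity is almost surely an absolutely convergent integral and a random variable
    (∀ᵐ ω ∂P, IntegrableOn (fun s : ℝ => Real.exp (-lam * s) * μ s.toNNReal ω)
      (Set.Ioi (0 : ℝ))) ∧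
    AEMeasurable (perpetuity lam μ) P ∧
    -- the explicit formulas for the two conditional c.d.f.s
    (∀ x : ℝ, ρ₁ / lam < x → x < ρ₂ / lam →
      perpetuityCDFGiven P lam μ ρ₁ x =
          limitConst ρ₁ ρ₂ α β lam *
            ∫ z in (ρ₁ / lam)..x, (ρ₂ - lam * z) * limitWeight ρ₁ ρ₂ α β lam z ∧
      perpetuityCDFGiven P lam μ ρ₂ x =
          (β * limitConst ρ₁ ρ₂ α β lam / α) *
            ∫ z in (ρ₁ / lam)..x, (lam * z - ρ₁) * limitWeight ρ₁ ρ₂ α β lam z) ∧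
    -- they are the c.d.f.s of scaled and shifted Beta distributions
    (∀ x : ℝ,
      perpetuityCDFGiven P lam μ ρ₁ x =
        (scaledBeta ρ₁ ρ₂ lam (α / lam) (β / lam + 1)).real (Set.Iic x) ∧
      perpetuityCDFGiven P lam μ ρ₂ x =
        (scaledBeta ρ₁ ρ₂ lam (α / lam + 1) (β / lam)).real (Set.Iic x)) := by
  obtain ⟨Y, hY⟩ := hμ.exists_isUpperIndicator hρ
  have ha : 0 < α / lam := by positivity
  have hb : 0 < β / lam := by positivity
  -- The stationary initial law enters only through the positivity of both initial probabilities.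
  have hu : ∀ x, perpetuityCDFGiven P lam μ ρ₁ x =
      (scaledBeta ρ₁ ρ₂ lam (α / lam) (β / lam + 1)).real (Set.Iic x) :=
    hY.perpetuityCDFGiven_eq hρ hα hβ hlam hμ 0 (h₁.trans_ne (by positivity)) ha (by positivity)
      (tailMoment_zero ha hb)
  have hv : ∀ x, perpetuityCDFGiven P lam μ ρ₂ x =
      (scaledBeta ρ₁ ρ₂ lam (α / lam + 1) (β / lam)).real (Set.Iic x) :=
    hY.perpetuityCDFGiven_eq hρ hα hβ hlam hμ 1 (h₂.trans_ne (by positivity)) (by positivity) hb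
      (tailMoment_one ha hb)
  have hae := hY.ae_integrableOn_discounted hρ hlam
  refine ⟨hae.mono fun ω h => h.1, ?_, fun x hx₁ hx₂ => ⟨?_, ?_⟩, fun x => ⟨hu x, hv x⟩⟩
  · have hm : Measurable fun ω => discountedTail lam (fun u => Y u ω) 0 :=
      (hY.measurable_discountedTail lam).comp measurable_prodMk_left
    exact ⟨_, ((hm.const_mul (ρ₂ - ρ₁)).const_add ρ₁).div_const lam, hae.mono fun ω h => h.2⟩
  · rw [hu, scaledBeta_real_Iic_eq_integral hρ hlam ha (by positivity) hx₁ hx₂,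
      limitConst_eq hα hβ hlam]
    congr 1
    refine intervalIntegral.integral_congr_ae (ae_of_all _ fun z hz => ?_)
    rw [Set.uIoc_of_le hx₁.le] at hz
    have hz₂ : 0 < ρ₂ - lam * z := by nlinarith [hz.2, (lt_div_iff₀ hlam).1 hx₂]
    -- The extra linear factor raises the exponent in `limitWeight` by one, to that of the `Beta(α /
    -- lam, β / lam + 1)` density.
    rw [limitWeight, show β / lam + 1 - 1 = (β / lam - 1) + 1 by ring, Real.rpow_add_one hz₂.ne']
    ring
  · rw [hv, scaledBeta_real_Iic_eq_integral hρ hlam (by positivity) hb hx₁ hx₂,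
      limitConst_mul_div_eq hα hβ hlam]
    congr 1
    refine intervalIntegral.integral_congr_ae (ae_of_all _ fun z hz => ?_)
    rw [Set.uIoc_of_le hx₁.le] at hz
    have hz₁ : 0 < lam * z - ρ₁ := by linarith [(div_lt_iff₀ hlam).1 hz.1]
    rw [limitWeight, show α / lam + 1 - 1 = (α / lam - 1) + 1 by ring, Real.rpow_add_one hz₁.ne']
    ring
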